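/- A binary contextuality scenario consists of a finite set $\mathcal M$ of measurements with outcomes in a finite set $\mathcal O$ and a family $\mathcal C$ of jointly measurable subsets (contexts) of $\mathcal M$, each with at most two elements. In each run, measurements $X,Y\in\mathcal M$ with $\{X,Y\}\in\mathcal C$ are performed, with outcomes $A,B\in\mathcal O$. A phenomenon $\mathcal P$ is a probability distribution $\mathcal P(ABXY)$ of these observable variables. It is *no-disturbance* if $\mathcal P(A|XY)=\mathcal P(A|X)$ and $\mathcal P(B|XY)=\mathcal P(B|Y)$ wherever these conditionals are defined. A *KS-inequality* is a linear inequality $\sum c_{abxy}\,\mathcal P(ab|xy)\le\beta$ over contexts that holds whenever $\mathcal P(ab|xy)=\int \mathcal P(a|x\lambda)\mathcal P(b|y\lambda)\,d\mu(\lambda)$ for all contexts $\{x,y\}$, with some probability measure $\mu$ on a space of hidden variables and some response functions. A *causal model* for $\mathcal P$ consists of a finite (possibly empty) set $\Lambda$ of latent variables (discrete or continuous, with values in standard Borel spaces), a directed acyclic graph $\mathcal G$ with nodes $\{A,B,X,Y\}\cup\Lambda$, and a joint probability distribution of all these variables with marginal $\mathcal P(ABXY)$ in which each variable is independent of its non-descendants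 in $\mathcal G$ conditional on its parents. The model has *no fine-tuning* if, for all pairwise disjoint sets $C,D,E$ of observable variables, conditional independence of $C$ and $D$ given $E$ in $\mathcal P$ implies that $C$ and $D$ are d-separated by $E$ in $\mathcal G$. **Corollary.** There exist quantum phenomena involving single systems that cannot be reproduced by any classical causal model without fine-tuning. Precisely: there are a binary contextuality scenario, a prime $d$, a density matrix $\rho$ on $\mathbb C^d$ (a single system: since $d$ is prime, $\mathbb C^d$ is not a tensor product of two spaces of dimension at least two), projective measurements $(E^m_o)_{o\in\mathcal O}$ on $\mathbb C^d$ for $m\in\mathcal M$, commuting whenever they belong to a common context, and a phenomenon of the form $\mathcal P(abxy)=\mathcal P(xy)\,\mathrm{tr}(\rho E^x_aE^y_b)$, supported on the contexts, that is no-disturbance and violates a KS-inequality (among contexts occurring with nonzero probability), such that no causal model for $\mathcal P$ has no fine-tuning. -/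

import Mathlib

open MeasureTheory ProbabilityTheory
open scoped ComplexOrder

/-! ### Directed acyclic graphs and d-separation -/

namespace Digraph

variable {V : Type}

/-- There are no directed cycles. -/
def IsAcyclic (G : Digraph V) : Prop :=
  ∀ v, ¬ Relation.TransGen G.Adj v v

/-- The parents (direct causes) of a node. -/
def parents (G : Digraph V) (v : V) : Set V :=
  {u | G.Adj u v}

/-- The descendants of a node: the nodes that are reached from it by a nonempty directed path. -/
def descendants (G : Digraph V) (v : V) : Set V :=
  {w | Relation.TransGen G.Adj v w}

/-- The non-descendants of a node (other than the node itself). -/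
def nonDescendants (G : Digraph V) (v : V) : Set V :=
  {w | w ≠ v ∧ w ∉ G.descendants v}

/-- A path from `x` to `y`: a sequence of distinct nodes, consecutive ones being linked by an edge
in either direction. -/
structure IsPath (G : Digraph V) (x y : V) (p : List V) : Prop where
  head : p.head? = some x
  last : p.getLast? = some y
  nodup : p.Nodup
  linked : p.IsChain (fun u v => G.Adj u v ∨ G.Adj v u)

/-- A path `p` is blocked by `Z` if it contains a chain or a fork whose middle node is in `Z`, or
an inverted fork whose middle node is not in `Z` and has no directed path to a member of `Z`. -/
def Blocks (G : Digraph V) (Z : Set V) (p : List V) : Prop :=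
  ∃ a b c, [a, b, c] <:+: p ∧
    ((((G.Adj a b ∧ G.Adj b c) ∨ (G.Adj c b ∧ G.Adj b a) ∨ (G.Adj b a ∧ G.Adj b c)) ∧ b ∈ Z) ∨
     ((G.Adj a b ∧ G.Adj c b) ∧ b ∉ Z ∧ ∀ z ∈ Z, z ∉ G.descendants b))

/-- `X` and `Y` are d-separated given `Z`: every path from `X` to `Y` is blocked by `Z`. -/
def DSep (G : Digraph V) (X Y Z : Set V) : Prop :=
  ∀ x ∈ X, ∀ y ∈ Y, ∀ p, G.IsPath x y p → G.Blocks Z p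

end Digraph

/-! ### Binary contextuality scenarios and phenomena -/

/-- A compatibility structure on the set `M` of measurements: a family of jointly measurable
subsets of `M`, each consisting of at most two measurements. -/
structure BinaryScenario (M : Type) where
  contexts : Set (Set M)
  binary : ∀ c ∈ contexts, c.ncard ≤ 2

/-- The four observable variables: measurement choices `X`, `Y`, with outcomes `A`, `B`. -/
inductive Obs : Type
  | A | B | X | Y
  deriving DecidableEq

instance : Fintype Obs :=
  ⟨{Obs.A, Obs.B, Obs.X, Obs.Y}, by intro v; cases v <;> simp⟩

/-- The values of the observable variables, for measurements in `M` and outcomes in `O`. -/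
def Obs.Val (M O : Type) : Obs → Type
  | A => O
  | B => O
  | X => M
  | Y => M

/-- The joint value `A = a`, `B = b`, `X = x`, `Y = y`. -/
def Obs.assign {M O : Type} (a b : O) (x y : M) : ∀ v, Obs.Val M O v
  | A => a
  | B => b
  | X => x
  | Y => y

/-- A phenomenon: a distribution of `A, B, X, Y` for which, in every run, the chosen measurements
are jointly measurable. -/
structure Phenomenon {M : Type} (S : BinaryScenario M) (O : Type) where
  dist : PMF (∀ v, Obs.Val M O v)
  compatible : ∀ ω ∈ dist.support, ({ω Obs.X, ω Obs.Y} : Set M) ∈ S.contexts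

namespace Phenomenon

variable {M O : Type} {S : BinaryScenario M}

/-- The probability that the variables in `s` take the values prescribed by `ω`. -/
noncomputable def prob (P : Phenomenon S O) (s : Set Obs) (ω : ∀ v, Obs.Val M O v) : ℝ :=
  (P.dist.toOuterMeasure {ω' | ∀ v ∈ s, ω' v = ω v}).toReal

/-- The conditional probability of the values `ω` of the variables in `s`, given those of the
variables in `t` (meaningful when `P.prob t ω ≠ 0`). -/
noncomputable def condProb (P : Phenomenon S O) (s t : Set Obs) (ω : ∀ v, Obs.Val M O v) : ℝ :=
  P.prob (s ∪ t) ω / P.prob t ω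

/-- Conditional independence of the variables in `C` and those in `D`, given those in `E`. -/
def CondIndep (P : Phenomenon S O) (C D E : Set Obs) : Prop :=
  ∀ ω, P.prob E ω ≠ 0 → P.condProb (C ∪ D) E ω = P.condProb C E ω * P.condProb D E ω

/-- `P(A|XY) = P(A|X)` and `P(B|XY) = P(B|Y)`, wherever these conditionals are defined. -/
def NoDisturbance (P : Phenomenon S O) : Prop :=
  ∀ ω, P.prob {Obs.X, Obs.Y} ω ≠ 0 →
    P.condProb {Obs.A} {Obs.X, Obs.Y} ω = P.condProb {Obs.A} {Obs.X} ω ∧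
    P.condProb {Obs.B} {Obs.X, Obs.Y} ω = P.condProb {Obs.B} {Obs.Y} ω

/-- The phenomenon is obtained by projective measurements on one quantum system with Hilbert space
`ℂ^d`, in a state `ρ`; jointly measurable measurements are given by commuting projectors. -/
def IsQuantum [Fintype O] (P : Phenomenon S O) (d : ℕ) : Prop :=
  ∃ (ρ : Matrix (Fin d) (Fin d) ℂ) (E : M → O → Matrix (Fin d) (Fin d) ℂ),
    ρ.PosSemidef ∧ ρ.trace = 1 ∧
    (∀ m o, IsStarProjection (E m o)) ∧ (∀ m, ∑ o, E m o = 1) ∧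
    (∀ m n, ({m, n} : Set M) ∈ S.contexts → ∀ a b, Commute (E m a) (E n b)) ∧
    ∀ a b x y,
      (P.prob Set.univ (Obs.assign a b x y) : ℂ) =
        P.prob {Obs.X, Obs.Y} (Obs.assign a b x y) * (ρ * (E x a * E y b)).trace

end Phenomenon

/-! ### Kochen-Specker inequalities -/

namespace BinaryScenario

variable {M O : Type}

/-- Conditional probabilities `q a b x y = P(ab|xy)` that are factorisable on the contexts of `S`:
`P(ab|xy) = ∫ P(a|xl) P(b|yl) dμ(l)` for a probability measure `μ` on a space of hidden variables
`l` and response functions `P(a|xl)`, `P(b|yl)`. -/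
def Factorisable [Fintype O] (S : BinaryScenario M) (q : O → O → M → M → ℝ) : Prop :=
  ∃ (L : Type) (_ : MeasurableSpace L) (μ : Measure L) (_ : IsProbabilityMeasure μ)
    (f g : O → M → L → ℝ),
    (∀ o m, Measurable (f o m)) ∧ (∀ o m, Measurable (g o m)) ∧
    (∀ o m l, 0 ≤ f o m l) ∧ (∀ o m l, 0 ≤ g o m l) ∧
    (∀ m l, ∑ o, f o m l = 1) ∧ (∀ m l, ∑ o, g o m l = 1) ∧
    ∀ x y, ({x, y} : Set M) ∈ S.contexts → ∀ a b, q a b x y = ∫ l, f a x l * g b y l ∂μ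

/-- The linear inequality `∑ c a b x y * P(ab|xy) ≤ β`, involving only contexts of `S`, is a
KS-inequality: it holds for all factorisable conditional probabilities. -/
def IsKSInequality [Fintype M] [Fintype O] (S : BinaryScenario M)
    (c : O → O → M → M → ℝ) (β : ℝ) : Prop :=
  (∀ a b x y, ({x, y} : Set M) ∉ S.contexts → c a b x y = 0) ∧
  ∀ q : O → O → M → M → ℝ, S.Factorisable q →
    ∑ a, ∑ b, ∑ x, ∑ y, c a b x y * q a b x y ≤ β

end BinaryScenario

/-- The phenomenon violates a KS-inequality (in which only those contexts enter that occur with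
nonzero probability, so that the conditional probabilities are defined). -/
def Phenomenon.ViolatesKSInequality {M O : Type} [Fintype M] [Fintype O] {S : BinaryScenario M}
    (P : Phenomenon S O) : Prop :=
  ∃ (c : O → O → M → M → ℝ) (β : ℝ), S.IsKSInequality c β ∧
    (∀ a b x y, P.prob {Obs.X, Obs.Y} (Obs.assign a b x y) = 0 → c a b x y = 0) ∧
    β < ∑ a, ∑ b, ∑ x, ∑ y,
      c a b x y * P.condProb {Obs.A, Obs.B} {Obs.X, Obs.Y} (Obs.assign a b x y)

/-! ### Causal models -/

/-- The values of the nodes of a causal graph: observables and latent variables. -/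
def NodeVal (M O : Type) {L : Type} (T : L → Type) : Obs ⊕ L → Type
  | .inl v => Obs.Val M O v
  | .inr l => T l

instance NodeVal.measurableSpace (M O : Type) {L : Type} (T : L → Type)
    [inst : ∀ l, MeasurableSpace (T l)] : ∀ n, MeasurableSpace (NodeVal M O T n)
  | .inl _ => ⊤
  | .inr l => inst l

instance Obs.finite_val (M O : Type) [hM : Finite M] [hO : Finite O] :
    ∀ v, Finite (Obs.Val M O v)
  | A => hO
  | B => hO
  | X => hM
  | Y => hM

instance NodeVal.standardBorelSpace (M O : Type) [Finite M] [Finite O] {L : Type} (T : L → Type)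
    [∀ l, MeasurableSpace (T l)] [inst : ∀ l, StandardBorelSpace (T l)] :
    ∀ n, StandardBorelSpace (NodeVal M O T n)
  | .inl v => by
      have : Finite (NodeVal M O T (.inl v)) := Obs.finite_val M O v
      have : DiscreteMeasurableSpace (NodeVal M O T (.inl v)) := ⟨fun _ => trivial⟩
      infer_instance
  | .inr l => inst l

/-- The joint value of the nodes in `s` is a measurable function of the values of all nodes. -/
theorem NodeVal.measurable_restrict (M O : Type) {L : Type} (T : L → Type)
    [∀ l, MeasurableSpace (T l)] (s : Set (Obs ⊕ L)) :
    Measurable (fun ω : (∀ n, NodeVal M O T n) => s.domRestrict ω) :=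
  measurable_pi_lambda _ fun _ => measurable_pi_apply _

/-- A (classical) causal model for a phenomenon: finitely many latent variables, discrete or
continuous, a directed acyclic graph on the observable and the latent variables, and a joint
distribution of all these variables, compatible with the graph (each variable is independent of
its non-descendants, conditional on its parents), whose marginal is the phenomenon. -/
structure CausalModel {M O : Type} [Finite M] [Finite O] {S : BinaryScenario M}
    (P : Phenomenon S O) where
  Latent : Type
  [finite_latent : Finite Latent]
  LatentVal : Latent → Type
  [measurableSpace_latentVal : ∀ l, MeasurableSpace (LatentVal l)]
  [standardBorelSpace_latentVal : ∀ l, StandardBorelSpace (LatentVal l)]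
  graph : Digraph (Obs ⊕ Latent)
  acyclic : graph.IsAcyclic
  μ : Measure (∀ n, NodeVal M O LatentVal n)
  [isProbabilityMeasure : IsProbabilityMeasure μ]
  causal_markov : ∀ n,
    (fun ω => ω n)
      ⟂ᵢ[(graph.parents n).domRestrict,
          NodeVal.measurable_restrict M O LatentVal (graph.parents n); μ]
        (graph.nonDescendants n).domRestrict
  marginal : ∀ ω : (∀ v, Obs.Val M O v), μ {ω' | ∀ v, ω' (.inl v) = ω v} = P.dist ω

/-- No fine-tuning: every conditional independence between observable variables that holds in the
phenomenon corresponds to a d-separation in the causal graph. -/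
def CausalModel.IsFaithful {M O : Type} [Finite M] [Finite O] {S : BinaryScenario M}
    {P : Phenomenon S O} (Γ : CausalModel P) : Prop :=
  ∀ C D E : Set Obs, Disjoint C D → Disjoint C E → Disjoint D E →
    P.CondIndep C D E → Γ.graph.DSep (Sum.inl '' C) (Sum.inl '' D) (Sum.inl '' E)

/-! The witness is the KCBS experiment on a qutrit: five projectors around a pentagon, consecutive
ones orthogonal, and a state that gives each of them the probability √5/5. The settings are uniform
on the fifteen ordered pairs of equal or consecutive measurements.

All five projectors have the same probability, so `A` alone is independent of the pair `X, Y`, and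
so is `B`. Without fine-tuning, both independences become d-separations by the empty set. Two nodes
with a common ancestor are joined by a path without inverted fork, which the empty set cannot block;
hence neither `A` nor `B` shares an ancestor with `X` or `Y`, and the ancestral closures of `{A, B}`
and `{X, Y}` are disjoint. By the Markov condition, disjoint parent-closed sets of nodes are
independent (`Digraph.IsAcyclic.indepFun_domRestrict`), so `A, B` jointly would be independent of
`X, Y` (`CausalModel.IsFaithful.condIndep_union`). But both outcomes are `true` with probability
√5/5 for equal settings and never for consecutive ones.

The KS-inequality is a parity bound: disagreement at all five consecutive pairs and agreement at all
equal pairs is impossible around an odd cycle, so hidden variables reach at most 4, while the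
quantum value is 2√5. -/

/-! ### Unblocked paths between nodes with a common ancestor -/

namespace Digraph

variable {V : Type} {G : Digraph V}

theorem IsAcyclic.not_adj_symm (hG : G.IsAcyclic) {a b : V} (h : G.Adj a b) : ¬ G.Adj b a :=
  fun h' => hG a ((Relation.TransGen.single h).tail h')

theorem IsAcyclic.nodup_of_isChain (hG : G.IsAcyclic) {l : List V} (h : l.IsChain G.Adj) :
    l.Nodup := by
  have h1 : l.IsChain (Relation.TransGen G.Adj) := h.imp fun _ _ => Relation.TransGen.single
  have h2 := List.isChain_iff_pairwise.1 h1
  exact h2.imp fun {a b} hab => by rintro rfl; exact hG _ hab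

theorem transGen_of_isChain_cons {z w : V} {l : List V} (h : (z :: l).IsChain G.Adj)
    (hw : w ∈ l) : Relation.TransGen G.Adj z w := by
  have h1 : (z :: l).IsChain (Relation.TransGen G.Adj) := h.imp fun _ _ => Relation.TransGen.single
  exact (List.pairwise_cons.1 (List.isChain_iff_pairwise.1 h1)).1 w hw

theorem reflTransGen_getLast_of_isChain {l : List V} (h : l.IsChain G.Adj) {w : V} (hw : w ∈ l) :
    Relation.ReflTransGen G.Adj w (l.getLast (List.ne_nil_of_mem hw)) := by
  obtain ⟨s, t, rfl⟩ := List.append_of_mem hw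
  have h1 : (w :: t).IsChain G.Adj := h.infix ⟨s, [], by simp⟩
  have h2 := List.relationReflTransGen_of_exists_isChain_cons t h1 rfl
  simpa using h2

/-- A path that goes up directed edges and then down directed edges contains no inverted fork. -/
theorem IsAcyclic.not_inverted_fork (hG : G.IsAcyclic) {z : V} {l : List V}
    (hl : (z :: l).IsChain G.Adj) {a b c : V} (hab : G.Adj a b) (hcb : G.Adj c b) :
    ∀ r : List V, (r ++ [z]).IsChain (fun u v => G.Adj v u) → ¬ [a, b, c] <:+: r ++ z :: l
  | [], _, h => by
      -- The triple lies in the descending part, where the second edge is `b → c`.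
      have := hl.infix h
      simp only [List.isChain_cons_cons] at this
      exact hG.not_adj_symm hcb this.2.1
  | w :: r, hr, h => by
      rw [List.cons_append, List.infix_cons_iff] at h
      rcases h with h | h
      -- A triple that starts in the ascending part has `b → a` as its first edge; the apex `z` may
      -- be `b`.
      · cases r with
        | nil =>
          simp only [List.nil_append, List.cons_prefix_cons] at h
          simp only [List.nil_append, List.cons_append, List.isChain_cons_cons] at hr
          obtain ⟨rfl, rfl, _⟩ := h
          exact hG.not_adj_symm hab hr.1
        | cons w' r =>
          simp only [List.cons_append, List.cons_prefix_cons] at h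
          simp only [List.cons_append, List.isChain_cons_cons] at hr
          obtain ⟨rfl, rfl, _⟩ := h
          exact hG.not_adj_symm hab hr.1
      · exact hG.not_inverted_fork hl hab hcb r (List.IsChain.tail hr) h

/-- Two nodes with a common ancestor are linked by a path that the empty set does not block. -/
theorem IsAcyclic.exists_isPath_not_blocks [Finite V] (hG : G.IsAcyclic) {z u v : V}
    (hu : Relation.ReflTransGen G.Adj z u) (hv : Relation.ReflTransGen G.Adj z v) :
    ∃ p, G.IsPath u v p ∧ ¬ G.Blocks ∅ p := by
  -- Minimal for `r` means having no proper descendant in the set: `m` is a lowest common ancestor,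
  -- so the directed paths from `m` to `u` and to `v` meet only at `m`.
  let r : V → V → Prop := fun a b => Relation.TransGen G.Adj b a
  have : IsTrans V r := ⟨fun a b c hab hbc => hbc.trans hab⟩
  have : Std.Irrefl r := ⟨fun a => hG a⟩
  obtain ⟨m, ⟨hmu, hmv⟩, hm⟩ := (Finite.wellFounded_of_trans_of_irrefl r).has_min
    {z | Relation.ReflTransGen G.Adj z u ∧ Relation.ReflTransGen G.Adj z v} ⟨z, hu, hv⟩
  obtain ⟨l₁, h₁, e₁⟩ := List.exists_isChain_cons_of_relationReflTransGen hmu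
  obtain ⟨l₂, h₂, e₂⟩ := List.exists_isChain_cons_of_relationReflTransGen hmv
  have hrev : (l₁.reverse ++ [m]).IsChain (fun u v => G.Adj v u) := by
    rw [← List.reverse_cons, List.isChain_reverse]
    exact h₁
  refine ⟨l₁.reverse ++ m :: l₂, ⟨?_, ?_, ?_, ?_⟩, ?_⟩
  · have : l₁.reverse ++ m :: l₂ = (m :: l₁).reverse ++ l₂ := by simp
    rw [this, List.head?_append, List.head?_reverse, List.getLast?_eq_some_getLast (by simp), e₁]
    rfl
  · rw [List.getLast?_append, List.getLast?_eq_some_getLast (by simp), e₂]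
    rfl
  · rw [List.nodup_append]
    have n₁ := hG.nodup_of_isChain h₁
    refine ⟨List.nodup_reverse.2 (List.nodup_cons.1 n₁).2, hG.nodup_of_isChain h₂, ?_⟩
    rintro a ha b hb rfl
    rw [List.mem_reverse] at ha
    -- A node on both branches would be a common ancestor strictly below `m`.
    refine hm a ⟨?_, ?_⟩ (transGen_of_isChain_cons h₁ ha)
    · simpa only [e₁] using reflTransGen_getLast_of_isChain h₁ (List.mem_cons_of_mem m ha)
    · simpa only [e₂] using reflTransGen_getLast_of_isChain h₂ hb
  · have hrev' : (l₁.reverse ++ [m]).IsChain (fun u v => G.Adj u v ∨ G.Adj v u) :=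
      hrev.imp fun _ _ => Or.inr
    have h₂' : (m :: l₂).IsChain (fun u v => G.Adj u v ∨ G.Adj v u) := h₂.imp fun _ _ => Or.inl
    exact List.isChain_split.2 ⟨hrev', h₂'⟩
  · rintro ⟨a, b, c, habc, ⟨-, hb⟩ | ⟨⟨hab, hcb⟩, -⟩⟩
    · exact hb
    · exact hG.not_inverted_fork h₂ hab hcb _ hrev habc

/-! ### Ancestral closures and d-separation by the empty set. -/

/-- The nodes from which some node of `s` is reached by a (possibly empty) directed path. -/
def ancestralClosure (G : Digraph V) (s : Set V) : Set V :=
  {u | ∃ v ∈ s, Relation.ReflTransGen G.Adj u v}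

theorem subset_ancestralClosure (s : Set V) : s ⊆ G.ancestralClosure s :=
  fun v hv => ⟨v, hv, .refl⟩

theorem parents_subset_ancestralClosure {s : Set V} {v : V} (hv : v ∈ G.ancestralClosure s) :
    G.parents v ⊆ G.ancestralClosure s := by
  obtain ⟨w, hw, h⟩ := hv
  exact fun u hu => ⟨w, hw, h.head hu⟩

/-- Sets that are d-separated by the empty set have no common ancestors. -/
theorem DSep.disjoint_ancestralClosure [Finite V] (hG : G.IsAcyclic) {s t : Set V}
    (h : G.DSep s t ∅) : Disjoint (G.ancestralClosure s) (G.ancestralClosure t) := by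
  rw [Set.disjoint_left]
  rintro z ⟨u, hu, hzu⟩ ⟨v, hv, hzv⟩
  obtain ⟨p, hp, hb⟩ := hG.exists_isPath_not_blocks hzu hzv
  exact hb (h u hu v hv p hp)

theorem ancestralClosure_union (s t : Set V) :
    G.ancestralClosure (s ∪ t) = G.ancestralClosure s ∪ G.ancestralClosure t := by
  ext u
  simp only [ancestralClosure, Set.mem_union, Set.mem_ofPred_eq, or_and_right, exists_or]

/-- A nonempty set of nodes has a member whose descendants lie outside it. -/
theorem IsAcyclic.exists_sink [Finite V] (hG : G.IsAcyclic) {s : Set V} (hs : s.Nonempty) :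
    ∃ n ∈ s, ∀ v ∈ s, v ∉ G.descendants n := by
  let r : V → V → Prop := fun a b => Relation.TransGen G.Adj b a
  have : IsTrans V r := ⟨fun a b c hab hbc => hbc.trans hab⟩
  have : Std.Irrefl r := ⟨fun a => hG a⟩
  obtain ⟨m, hms, hm⟩ := (Finite.wellFounded_of_trans_of_irrefl r).has_min s hs
  exact ⟨m, hms, fun v hv hmv => hm v hv hmv⟩

end Digraph

/-! ### Independence of parent-closed sets of variables -/

/-- Contraction: a σ-algebra `m₃` that, given a part `m₀` of `m₁`, is independent of `m₁` and `m₂`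
can be joined to `m₁` while keeping the independence of `m₂`. -/
theorem ProbabilityTheory.Indep.sup_left_of_condIndep {Ω : Type*} {m₀ m₁ m₂ m₃ mΩ : MeasurableSpace Ω}
    [StandardBorelSpace Ω] {μ : Measure Ω} [IsProbabilityMeasure μ]
    (h₀ : m₀ ≤ mΩ) (h₁ : m₁ ≤ mΩ) (h₂ : m₂ ≤ mΩ) (h₃ : m₃ ≤ mΩ) (h₀₁ : m₀ ≤ m₁)
    (hi : Indep m₁ m₂ μ) (hc : CondIndep m₀ m₃ (m₁ ⊔ m₂) h₀ μ) : Indep (m₃ ⊔ m₁) m₂ μ := by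
  have h₁₂ : m₁ ⊔ m₂ ≤ mΩ := sup_le h₁ h₂
  -- The probability of `s` given `m₀` may be integrated over any event `t` of `m₁ ⊔ m₂`:
  -- conditional independence splits off the factor for `s`, which is then pulled back inside the
  -- conditional expectation.
  have key : ∀ s t, MeasurableSet[m₃] s → MeasurableSet[m₁ ⊔ m₂] t →
      μ.real (s ∩ t) = ∫ ω, t.indicator (μ[s.indicator (fun _ => (1 : ℝ)) | m₀]) ω ∂μ := by
    intro s t hs ht
    have e := (condIndep_iff m₀ m₃ (m₁ ⊔ m₂) h₀ h₃ h₁₂ μ).1 hc s t hs ht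
    set h := μ[s.indicator (fun _ => (1 : ℝ)) | m₀] with hh
    have it : Integrable (t.indicator (fun _ => (1 : ℝ))) μ :=
      (integrable_const 1).indicator (h₁₂ t ht)
    have hm : h * t.indicator (fun _ => (1 : ℝ)) = t.indicator h := by
      ext ω; by_cases hω : ω ∈ t <;> simp [hω]
    have ih : Integrable (h * t.indicator (fun _ => (1 : ℝ))) μ := by
      rw [hm]; exact integrable_condExp.indicator (h₁₂ t ht)
    have e' := condExp_mul_of_stronglyMeasurable_left (m := m₀) (μ := μ) (f := h)
      stronglyMeasurable_condExp ih it
    calc μ.real (s ∩ t) = ∫ ω, (s ∩ t).indicator (fun _ => (1 : ℝ)) ω ∂μ := by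
          rw [integral_indicator_const _ ((h₃ s hs).inter (h₁₂ t ht))]; simp
      _ = ∫ ω, (μ[(s ∩ t).indicator (fun _ => (1 : ℝ)) | m₀]) ω ∂μ := (integral_condExp h₀).symm
      _ = ∫ ω, (μ[h * t.indicator (fun _ => (1 : ℝ)) | m₀]) ω ∂μ :=
          integral_congr_ae (e.trans e'.symm)
      _ = ∫ ω, (h * t.indicator (fun _ => (1 : ℝ))) ω ∂μ := integral_condExp h₀
      _ = _ := by rw [hm]
  -- It suffices to test independence on intersections `s ∩ r`, a π-system that generates `m₃ ⊔ m₁`.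
  have hpi : IsPiSystem (Set.image2 (· ∩ ·) {s | MeasurableSet[m₃] s} {r | MeasurableSet[m₁] r}) := by
    rintro _ ⟨s, hs, r, hr, rfl⟩ _ ⟨s', hs', r', hr', rfl⟩ -
    exact ⟨s ∩ s', MeasurableSet.inter hs hs', r ∩ r', MeasurableSet.inter hr hr',
      Set.inter_inter_inter_comm _ _ _ _⟩
  have hgen : m₃ ⊔ m₁ = MeasurableSpace.generateFrom
      (Set.image2 (· ∩ ·) {s | MeasurableSet[m₃] s} {r | MeasurableSet[m₁] r}) := by
    apply le_antisymm
    · refine sup_le (fun s hs => ?_) (fun r hr => ?_)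
      · exact MeasurableSpace.measurableSet_generateFrom
          ⟨s, hs, Set.univ, MeasurableSet.univ, Set.inter_univ s⟩
      · exact MeasurableSpace.measurableSet_generateFrom
          ⟨Set.univ, MeasurableSet.univ, r, hr, Set.univ_inter r⟩
    · refine MeasurableSpace.generateFrom_le ?_
      rintro _ ⟨s, hs, r, hr, rfl⟩
      exact MeasurableSet.inter ((le_sup_left : m₃ ≤ m₃ ⊔ m₁) s hs)
        ((le_sup_right : m₁ ≤ m₃ ⊔ m₁) r hr)
  refine IndepSets.indep (sup_le h₃ h₁) h₂ hpi (@MeasurableSpace.isPiSystem_measurableSet Ω m₂) hgen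
    (@MeasurableSpace.generateFrom_measurableSet Ω m₂).symm ?_
  rw [IndepSets_iff]
  rintro _ q ⟨s, hs, r, hr, rfl⟩ hq
  have hs : MeasurableSet[m₃] s := hs
  have hr : MeasurableSet[m₁] r := hr
  have hq : MeasurableSet[m₂] q := hq
  have hr' : MeasurableSet[m₁ ⊔ m₂] r := (le_sup_left : m₁ ≤ m₁ ⊔ m₂) r hr
  have hq' : MeasurableSet[m₁ ⊔ m₂] q := (le_sup_right : m₂ ≤ m₁ ⊔ m₂) q hq
  have k₁ := key s r hs hr'
  have k₂ := key s (r ∩ q) hs (hr'.inter hq')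
  set h := μ[s.indicator (fun _ => (1 : ℝ)) | m₀] with hh
  -- Here `m₀ ≤ m₁` enters: `h` restricted to `r` is `m₁`-measurable, hence independent of `q`, and
  -- its integral over `q` factors.
  have mh : Measurable[m₁] (r.indicator h) :=
    Measurable.indicator ((stronglyMeasurable_condExp (m := m₀)).measurable.mono h₀₁ le_rfl) hr
  have mq : Measurable[m₂] (q.indicator (fun _ => (1 : ℝ))) :=
    Measurable.indicator measurable_const hq
  have hif : IndepFun (r.indicator h) (q.indicator (fun _ => (1 : ℝ))) μ := by
    rw [IndepFun_iff_Indep]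
    exact indep_of_indep_of_le_left (indep_of_indep_of_le_right hi mq.comap_le) mh.comap_le
  have hint := hif.integral_mul_eq_mul_integral
    (mh.mono h₁ le_rfl).aestronglyMeasurable (mq.mono h₂ le_rfl).aestronglyMeasurable
  have hprod : r.indicator h * q.indicator (fun _ => (1 : ℝ)) = (r ∩ q).indicator h := by
    ext ω; by_cases h1 : ω ∈ r <;> by_cases h2 : ω ∈ q <;> simp [h1, h2]
  rw [hprod, ← k₂, ← k₁, integral_indicator_const _ (h₂ q hq), smul_eq_mul, mul_one,
    ← Set.inter_assoc] at hint
  rw [← ENNReal.toReal_eq_toReal_iff' (measure_ne_top _ _)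
    (ENNReal.mul_ne_top (measure_ne_top _ _) (measure_ne_top _ _)), ENNReal.toReal_mul]
  exact hint

/-- Joint variables of disjoint parent-closed sets of nodes are independent under the causal Markov
condition. -/
theorem Digraph.IsAcyclic.indepFun_domRestrict {V : Type} [Finite V] {G : Digraph V}
    (hG : G.IsAcyclic) {T : V → Type} [∀ v, MeasurableSpace (T v)] [∀ v, StandardBorelSpace (T v)]
    {μ : Measure (∀ v, T v)} [IsProbabilityMeasure μ]
    (hr : ∀ s : Set V, Measurable (fun ω : (∀ v, T v) => s.domRestrict ω))
    (hM : ∀ n, (fun ω => ω n) ⟂ᵢ[(G.parents n).domRestrict, hr (G.parents n); μ]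
      (G.nonDescendants n).domRestrict)
    {U W : Set V} (hU : ∀ v ∈ U, G.parents v ⊆ U) (hW : ∀ v ∈ W, G.parents v ⊆ W)
    (hd : Disjoint U W) :
    IndepFun (fun ω : (∀ v, T v) => U.domRestrict ω) (fun ω => W.domRestrict ω) μ := by
  have mono : ∀ {s t : Set V}, s ⊆ t →
      MeasurableSpace.comap (fun ω : (∀ v, T v) => s.domRestrict ω) inferInstance ≤
      MeasurableSpace.comap (fun ω : (∀ v, T v) => t.domRestrict ω) inferInstance := by
    intro s t hst
    have : (fun ω : (∀ v, T v) => s.domRestrict ω) =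
      (fun (f : ∀ v : t, T v) (v : s) => f ⟨v, hst v.2⟩) ∘ (fun ω => t.domRestrict ω) := rfl
    rw [this, ← MeasurableSpace.comap_comp]
    exact MeasurableSpace.comap_mono
      (measurable_pi_lambda _ fun v => measurable_pi_apply _).comap_le
  obtain ⟨k, hk⟩ : ∃ k, (U ∪ W).ncard = k := ⟨_, rfl⟩
  induction k generalizing U W with
  | zero =>
    have hUe : U = ∅ := by
      have := (Set.ncard_eq_zero (Set.toFinite _)).1 hk
      exact (Set.union_empty_iff.1 this).1
    subst hUe
    have : (fun ω : (∀ v, T v) => (∅ : Set V).domRestrict ω) =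
        fun _ v => (Set.notMem_empty _ v.2).elim := by
      ext ω v; exact (Set.notMem_empty _ v.2).elim
    rw [this]
    exact indepFun_const_left _ _
  | succ k ih =>
    -- Removing a sink `n` of `U ∪ W` keeps both sets parent-closed, and all remaining nodes are
    -- non-descendants of `n`. The Markov condition at `n` and contraction then put `n` back. The
    -- step is stated for arbitrary `U`, `W` because the sink may lie in either.
    have step : ∀ {U W : Set V}, (∀ v ∈ U, G.parents v ⊆ U) → (∀ v ∈ W, G.parents v ⊆ W) →
        Disjoint U W → (U ∪ W).ncard = k + 1 → ∀ n ∈ U, (∀ v ∈ U ∪ W, v ∉ G.descendants n) →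
        IndepFun (fun ω : (∀ v, T v) => U.domRestrict ω) (fun ω => W.domRestrict ω) μ := by
      intro U W hU hW hd hk n hn hsink
      have hnW : n ∉ W := Set.disjoint_left.1 hd hn
      have hpn : G.parents n ⊆ U \ {n} := fun v hv =>
        ⟨hU n hn hv, by rintro rfl; exact hG _ (.single hv)⟩
      have hU' : ∀ v ∈ U \ {n}, G.parents v ⊆ U \ {n} := fun v hv w hw =>
        ⟨hU v hv.1 hw, by rintro rfl; exact hsink v (Or.inl hv.1) (.single hw)⟩
      have hunion : (U \ {n}) ∪ W = (U ∪ W) \ {n} := by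
        rw [Set.union_sdiff_distrib, Set.sdiff_singleton_eq_self hnW]
      have hi := ih hU' hW (hd.mono_left Set.sdiff_subset) (by
        rw [hunion, Set.ncard_sdiff_singleton_of_mem (Set.mem_union_left W hn), hk]; rfl)
      have hnd : (U \ {n}) ∪ W ⊆ G.nonDescendants n := by
        rw [hunion]; exact fun v hv => ⟨hv.2, hsink v hv.1⟩
      have hc := condIndep_of_condIndep_of_le_right
        ((condIndepFun_iff_condIndep _ _ _ _ _).1 (hM n))
        (sup_le (mono (Set.subset_union_left.trans hnd)) (mono (Set.subset_union_right.trans hnd)))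
      have hs := Indep.sup_left_of_condIndep (hr _).comap_le (hr _).comap_le (hr _).comap_le
        (measurable_pi_apply n).comap_le (mono hpn) ((IndepFun_iff_Indep _ _ _).1 hi) hc
      rw [IndepFun_iff_Indep]
      refine indep_of_indep_of_le_left hs ?_
      rw [MeasurableSpace.pi, MeasurableSpace.comap_iSup]
      refine iSup_le fun v => ?_
      rw [MeasurableSpace.comap_comp]
      by_cases hv : (v : V) = n
      · obtain ⟨v, hvU⟩ := v
        obtain rfl : v = n := hv
        exact le_sup_left
      · refine le_sup_of_le_right ?_
        have : (fun f : (∀ v : U, T v) => f v) ∘ (fun ω : (∀ v, T v) => U.domRestrict ω) =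
          (fun f : (∀ v : (U \ {n} : Set V), T v) => f ⟨v, v.2, hv⟩) ∘
            (fun ω => (U \ {n}).domRestrict ω) := rfl
        rw [this, ← MeasurableSpace.comap_comp]
        exact MeasurableSpace.comap_mono
          (measurable_pi_apply (⟨v, v.2, hv⟩ : (U \ {n} : Set V))).comap_le
    obtain ⟨n, hn, hsink⟩ := hG.exists_sink (s := U ∪ W)
      (Set.nonempty_of_ncard_ne_zero (by omega))
    rcases hn with hn | hn
    · exact step hU hW hd hk n hn hsink
    · rw [Set.union_comm] at hk hsink
      exact (step hW hU hd.symm hk n hn hsink).symm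

/-! ### Consequences of faithfulness -/

theorem Phenomenon.prob_empty {M O : Type} {S : BinaryScenario M} (P : Phenomenon S O)
    (ω : ∀ v, Obs.Val M O v) : P.prob ∅ ω = 1 := by
  have h : P.dist.toOuterMeasure {ω' | ∀ v ∈ (∅ : Set Obs), ω' v = ω v} = 1 := by
    rw [PMF.toOuterMeasure_apply_eq_one_iff]
    exact fun _ _ v hv => hv.elim
  rw [Phenomenon.prob, h, ENNReal.toReal_one]

theorem Phenomenon.condIndep_empty_iff {M O : Type} {S : BinaryScenario M} (P : Phenomenon S O)
    (C D : Set Obs) :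
    P.CondIndep C D ∅ ↔ ∀ ω, P.prob (C ∪ D) ω = P.prob C ω * P.prob D ω := by
  simp [Phenomenon.CondIndep, Phenomenon.condProb, Phenomenon.prob_empty]

namespace CausalModel

attribute [instance] finite_latent measurableSpace_latentVal standardBorelSpace_latentVal
  isProbabilityMeasure

variable {M O : Type} [Finite M] [Finite O] {S : BinaryScenario M} {P : Phenomenon S O}

theorem measurableSet_eq (Γ : CausalModel P) {U : Set (Obs ⊕ Γ.Latent)} {s : Set Obs}
    (hs : Sum.inl '' s ⊆ U) (ω : ∀ v, Obs.Val M O v) :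
    MeasurableSet {f : ∀ n : U, NodeVal M O Γ.LatentVal n |
      ∀ v (hv : v ∈ s), f ⟨.inl v, hs ⟨v, hv, rfl⟩⟩ = ω v} := by
  have : {f : ∀ n : U, NodeVal M O Γ.LatentVal n |
      ∀ v (hv : v ∈ s), f ⟨.inl v, hs ⟨v, hv, rfl⟩⟩ = ω v} =
      ⋂ v, ⋂ hv : v ∈ s, (fun f : ∀ n : U, NodeVal M O Γ.LatentVal n =>
        f ⟨.inl v, hs ⟨v, hv, rfl⟩⟩) ⁻¹' {ω v} := by
    ext f
    simp only [Set.mem_iInter]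
    rfl
  rw [this]
  refine MeasurableSet.iInter fun v => MeasurableSet.iInter fun hv => ?_
  exact measurable_pi_apply (⟨.inl v, hs ⟨v, hv, rfl⟩⟩ : U) trivial

/-- The marginal condition speaks of single joint values only; summing over the finitely many values
compatible with the event extends it to partial assignments. -/
theorem prob_eq (Γ : CausalModel P) (s : Set Obs) (ω : ∀ v, Obs.Val M O v) :
    P.prob s ω = (Γ.μ {ω' | ∀ v ∈ s, ω' (.inl v) = ω v}).toReal := by
  have := Obs.finite_val M O
  let π : (∀ n, NodeVal M O Γ.LatentVal n) → ∀ v, Obs.Val M O v := fun ω' v => ω' (.inl v)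
  have hπ : ∀ y, MeasurableSet (π ⁻¹' {y}) := by
    intro y
    have : π ⁻¹' {y} = (fun ω' => Set.univ.domRestrict ω') ⁻¹' {f | ∀ v (hv : v ∈ Set.univ),
        f ⟨.inl v, Set.subset_univ (Sum.inl '' Set.univ) ⟨v, hv, rfl⟩⟩ = y v} := by
      ext ω'
      exact ⟨fun h v _ => congrFun h v, fun h => funext fun v => h v trivial⟩
    rw [this]
    exact NodeVal.measurable_restrict M O Γ.LatentVal Set.univ (Γ.measurableSet_eq _ y)
  have hm : ∀ y, Γ.μ (π ⁻¹' {y}) = P.dist y := by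
    intro y
    rw [← Γ.marginal y]
    congr 1
    ext ω'
    exact funext_iff
  have h := tsum_measure_preimage_singleton (μ := Γ.μ) (f := π)
    (s := {ω' | ∀ v ∈ s, ω' v = ω v}) (Set.toFinite _).countable fun y _ => hπ y
  have h' : P.dist.toOuterMeasure {ω' | ∀ v ∈ s, ω' v = ω v} =
      Γ.μ (π ⁻¹' {ω' | ∀ v ∈ s, ω' v = ω v}) := by
    rw [← h, PMF.toOuterMeasure_apply, ← tsum_subtype]
    exact tsum_congr fun y => (hm y).symm
  exact congrArg ENNReal.toReal h'

/-- In a model without fine-tuning, variables that are separately independent of `D` are jointly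
independent of `D`. -/
theorem IsFaithful.condIndep_union {Γ : CausalModel P} (hΓ : Γ.IsFaithful) {C₁ C₂ D : Set Obs}
    (hd₁ : Disjoint C₁ D) (hd₂ : Disjoint C₂ D) (h₁ : P.CondIndep C₁ D ∅)
    (h₂ : P.CondIndep C₂ D ∅) : P.CondIndep (C₁ ∪ C₂) D ∅ := by
  have s₁ := hΓ C₁ D ∅ hd₁ (Set.disjoint_empty _) (Set.disjoint_empty _) h₁
  have s₂ := hΓ C₂ D ∅ hd₂ (Set.disjoint_empty _) (Set.disjoint_empty _) h₂
  rw [Set.image_empty] at s₁ s₂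
  -- Pairwise independence need not be joint, but sharing no ancestor with `D` passes to unions.
  have hdisj : Disjoint (Γ.graph.ancestralClosure (Sum.inl '' (C₁ ∪ C₂)))
      (Γ.graph.ancestralClosure (Sum.inl '' D)) := by
    rw [Set.image_union, Digraph.ancestralClosure_union, Set.disjoint_union_left]
    exact ⟨s₁.disjoint_ancestralClosure Γ.acyclic, s₂.disjoint_ancestralClosure Γ.acyclic⟩
  have hi := Γ.acyclic.indepFun_domRestrict (NodeVal.measurable_restrict M O Γ.LatentVal)
    Γ.causal_markov (fun v => Digraph.parents_subset_ancestralClosure)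
    (fun v => Digraph.parents_subset_ancestralClosure) hdisj
  rw [Phenomenon.condIndep_empty_iff]
  intro ω
  have hm := hi.measure_inter_preimage_eq_mul _ _
    (Γ.measurableSet_eq (Digraph.subset_ancestralClosure _) ω)
    (Γ.measurableSet_eq (Digraph.subset_ancestralClosure _) ω)
  have e : ∀ s, (fun ω' : (∀ n, NodeVal M O Γ.LatentVal n) =>
      (Γ.graph.ancestralClosure (Sum.inl '' s)).domRestrict ω') ⁻¹'
        {f | ∀ v (hv : v ∈ s), f ⟨.inl v, Digraph.subset_ancestralClosure _ ⟨v, hv, rfl⟩⟩ = ω v} =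
      {ω' | ∀ v ∈ s, ω' (.inl v) = ω v} := fun s => rfl
  rw [e, e] at hm
  rw [prob_eq Γ, prob_eq Γ, prob_eq Γ, ← ENNReal.toReal_mul]
  refine congrArg ENNReal.toReal (Eq.trans ?_ hm)
  congr 1
  ext ω'
  exact ⟨fun h => ⟨fun v hv => h v (.inl hv), fun v hv => h v (.inr hv)⟩,
    fun h v hv => hv.elim (h.1 v) (h.2 v)⟩

end CausalModel

/-! ### The Klyachko–Can–Binicioğlu–Shumovsky scenario -/

/-- Five measurements in a cycle, of which the consecutive ones are jointly measurable. -/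
def pentagonScenario : BinaryScenario (Fin 5) where
  contexts := {c | ∃ x, c = {x} ∨ c = {x, x + 1}}
  binary := by
    rintro c ⟨x, rfl | rfl⟩
    · simp
    · exact (Set.ncard_insert_le _ _).trans (by simp)

/-- Equal or consecutive measurements. -/
abbrev pentagonCompatible (x y : Fin 5) : Prop := x = y ∨ y = x + 1 ∨ x = y + 1

theorem pair_mem_pentagonScenario_iff (x y : Fin 5) :
    ({x, y} : Set (Fin 5)) ∈ pentagonScenario.contexts ↔ pentagonCompatible x y := by
  constructor
  · rintro ⟨z, h | h⟩
    · have hx : x ∈ ({z} : Set (Fin 5)) := h ▸ Set.mem_insert _ _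
      have hy : y ∈ ({z} : Set (Fin 5)) := h ▸ Set.mem_insert_of_mem _ rfl
      exact Or.inl ((Set.mem_singleton_iff.1 hx).trans (Set.mem_singleton_iff.1 hy).symm)
    · rcases Set.pair_eq_pair_iff.1 h with ⟨rfl, rfl⟩ | ⟨rfl, rfl⟩
      · exact Or.inr (Or.inl rfl)
      · exact Or.inr (Or.inr rfl)
  · rintro (rfl | rfl | rfl)
    · exact ⟨x, Or.inl (by simp)⟩
    · exact ⟨x, Or.inr rfl⟩
    · exact ⟨y, Or.inr (Set.pair_comm _ _)⟩

/-! ### The KCBS statistics. -/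

/-- The probabilities of the outcomes of two jointly measurable KCBS measurements: equal
measurements give equal outcomes, consecutive ones never both the outcome `true`. -/
noncomputable def kcbsCond (a b : Bool) (x y : Fin 5) : ℝ :=
  match a, b with
  | true, true => if x = y then √5 / 5 else 0
  | true, false => if x = y then 0 else √5 / 5
  | false, true => if x = y then 0 else √5 / 5
  | false, false => if x = y then 1 - √5 / 5 else 1 - 2 * (√5 / 5)

/-- The outcome distribution of a single KCBS measurement. -/
noncomputable def kcbsMarginal (a : Bool) : ℝ := if a then √5 / 5 else 1 - √5 / 5

/-- The uniform distribution on the fifteen compatible pairs of measurements. -/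
noncomputable def kcbsChoice (x y : Fin 5) : ℝ := if pentagonCompatible x y then 1 / 15 else 0

theorem kcbsCond_nonneg (a b : Bool) (x y : Fin 5) : 0 ≤ kcbsCond a b x y := by
  have h0 : 0 ≤ √5 := Real.sqrt_nonneg 5
  -- Needed for the entry `1 - 2 * (√5 / 5)`.
  have h1 : √5 ≤ 5 / 2 := Real.sqrt_le_iff.2 ⟨by norm_num, by norm_num⟩
  cases a <;> cases b <;> simp only [kcbsCond] <;> split_ifs <;> linarith

@[simp]
theorem sum_kcbsCond_right (a : Bool) (x y : Fin 5) :
    ∑ b, kcbsCond a b x y = kcbsMarginal a := by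
  cases a <;> simp only [kcbsCond, kcbsMarginal, Fintype.sum_bool] <;> split_ifs <;> grind

@[simp]
theorem sum_kcbsCond_left (b : Bool) (x y : Fin 5) :
    ∑ a, kcbsCond a b x y = kcbsMarginal b := by
  cases b <;> simp only [kcbsCond, kcbsMarginal, Fintype.sum_bool] <;> split_ifs <;> grind

@[simp]
theorem sum_kcbsMarginal : ∑ a, kcbsMarginal a = 1 := by
  simp [kcbsMarginal]

theorem kcbsChoice_nonneg (x y : Fin 5) : 0 ≤ kcbsChoice x y := by
  unfold kcbsChoice; split_ifs <;> norm_num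

@[simp]
theorem sum_kcbsChoice_right (x : Fin 5) : ∑ y, kcbsChoice x y = 1 / 5 := by
  have h : (Finset.univ.filter (pentagonCompatible x)).card = 3 := by revert x; decide
  simp only [kcbsChoice]
  rw [Finset.sum_ite, Finset.sum_const, Finset.sum_const_zero, h]
  norm_num

@[simp]
theorem sum_kcbsChoice_left (y : Fin 5) : ∑ x, kcbsChoice x y = 1 / 5 := by
  have h : (Finset.univ.filter fun x => pentagonCompatible x y).card = 3 := by revert y; decide
  simp only [kcbsChoice]
  rw [Finset.sum_ite, Finset.sum_const, Finset.sum_const_zero, h]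
  norm_num

@[simp]
theorem sum_sum_kcbsChoice : ∑ x, ∑ y, kcbsChoice x y = 1 := by
  simp only [sum_kcbsChoice_right]; simp

/-- The joint distribution of the outcomes and the choices of measurements. -/
noncomputable def kcbsWeight (t : Bool × Bool × Fin 5 × Fin 5) : ℝ :=
  kcbsChoice t.2.2.1 t.2.2.2 * kcbsCond t.1 t.2.1 t.2.2.1 t.2.2.2

theorem kcbsWeight_nonneg (t : Bool × Bool × Fin 5 × Fin 5) : 0 ≤ kcbsWeight t :=
  mul_nonneg (kcbsChoice_nonneg _ _) (kcbsCond_nonneg _ _ _ _)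

theorem sum_kcbsWeight : ∑ t, kcbsWeight t = 1 := by
  have h : ∀ x y, ∑ a, ∑ b, kcbsWeight (a, b, x, y) = kcbsChoice x y := by
    intro x y
    simp only [kcbsWeight, ← Finset.mul_sum, sum_kcbsCond_right, sum_kcbsMarginal, mul_one]
  rw [← sum_sum_kcbsChoice]
  simp only [← h, Fintype.sum_prod_type, Fintype.sum_bool, Finset.sum_add_distrib]

/-- The KCBS experiment on a spin-1 system, with a random choice of compatible measurements. -/
noncomputable def kcbsPhenomenon : Phenomenon pentagonScenario Bool where
  dist := (PMF.ofFintype (fun t => ENNReal.ofReal (kcbsWeight t)) (by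
    rw [← ENNReal.ofReal_sum_of_nonneg fun t _ => kcbsWeight_nonneg t, sum_kcbsWeight,
      ENNReal.ofReal_one])).map fun t => Obs.assign t.1 t.2.1 t.2.2.1 t.2.2.2
  compatible := by
    intro ω hω
    rw [PMF.mem_support_map_iff] at hω
    obtain ⟨⟨a, b, x, y⟩, ht, rfl⟩ := hω
    change ({x, y} : Set (Fin 5)) ∈ _
    rw [pair_mem_pentagonScenario_iff]
    by_contra hxy
    rw [PMF.mem_support_iff, PMF.ofFintype_apply] at ht
    exact ht (by simp [kcbsWeight, kcbsChoice, hxy])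

/-! ### Marginals of the joint distribution. -/

theorem forall_mem_obs_iff {s : Set Obs} {p : Obs → Prop} :
    (∀ v ∈ s, p v) ↔ (.X ∈ s → p .X) ∧ (.Y ∈ s → p .Y) ∧ (.A ∈ s → p .A) ∧ (.B ∈ s → p .B) :=
  ⟨fun h => ⟨h _, h _, h _, h _⟩, fun h v => by
    cases v
    exacts [h.2.2.1, h.2.2.2, h.1, h.2.1]⟩

theorem Obs.exists_eq_assign {M O : Type} (ω : ∀ v, Obs.Val M O v) :
    ∃ a b x y, ω = Obs.assign a b x y :=
  ⟨ω .A, ω .B, ω .X, ω .Y, by funext v; cases v <;> rfl⟩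

-- One formula for all marginals: a variable outside `s` has a vacuous condition and is summed
-- freely. The outcomes are summed inside the settings, so that `simp` can collapse them by the row
-- and column sums of `kcbsCond` before summing `kcbsChoice`.
open Classical in
theorem kcbsPhenomenon_prob (s : Set Obs) (a b : Bool) (x y : Fin 5) :
    kcbsPhenomenon.prob s (Obs.assign a b x y) =
      ∑ x', if .X ∈ s → x' = x then ∑ y', if .Y ∈ s → y' = y then
        ∑ a', if .A ∈ s → a' = a then ∑ b', if .B ∈ s → b' = b then
          kcbsChoice x' y' * kcbsCond a' b' x' y' else 0 else 0 else 0 else 0 := by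
  rw [Phenomenon.prob, kcbsPhenomenon, PMF.toOuterMeasure_map_apply,
    PMF.toOuterMeasure_apply_fintype, ENNReal.toReal_sum]
  · have h : ∀ t : Bool × Bool × Fin 5 × Fin 5, (Set.indicator
        ((fun t : Bool × Bool × Fin 5 × Fin 5 => Obs.assign t.1 t.2.1 t.2.2.1 t.2.2.2) ⁻¹'
          {ω' | ∀ v ∈ s, ω' v = Obs.assign a b x y v})
            (fun t => ENNReal.ofReal (kcbsWeight t)) t).toReal =
        if .X ∈ s → t.2.2.1 = x then if .Y ∈ s → t.2.2.2 = y then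
          if .A ∈ s → t.1 = a then if .B ∈ s → t.2.1 = b then kcbsWeight t
            else 0 else 0 else 0 else 0 := by
      intro t
      rw [Set.indicator_apply, Set.mem_preimage, Set.mem_ofPred_eq, forall_mem_obs_iff,
        apply_ite ENNReal.toReal, ENNReal.toReal_ofReal (kcbsWeight_nonneg t),
        ENNReal.toReal_zero]
      by_cases h : (.X ∈ s → t.2.2.1 = x) ∧ (.Y ∈ s → t.2.2.2 = y) ∧ (.A ∈ s → t.1 = a) ∧
          (.B ∈ s → t.2.1 = b)
      · rw [if_pos h.1, if_pos h.2.1, if_pos h.2.2.1, if_pos h.2.2.2]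
        exact if_pos h
      · refine (if_neg h).trans ?_
        split_ifs with h₁ h₂ h₃ h₄
        · exact (h ⟨h₁, h₂, h₃, h₄⟩).elim
        all_goals rfl
    refine (Finset.sum_congr rfl fun t _ => h t).trans ?_
    simp only [Fintype.sum_prod_type]
    have e : ∀ F : Bool → Bool → Fin 5 → Fin 5 → ℝ,
        ∑ a, ∑ b, ∑ x, ∑ y, F a b x y = ∑ x, ∑ y, ∑ a, ∑ b, F a b x y := by
      intro F
      simp only [Fintype.sum_bool, Finset.sum_add_distrib]
    rw [e]
    refine Finset.sum_congr rfl fun x' _ => ?_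
    split_ifs
    · refine Finset.sum_congr rfl fun y' _ => ?_
      split_ifs
      · refine Finset.sum_congr rfl fun a' _ => ?_
        split_ifs
        · rfl
        · simp
      · simp
    · simp
  · intro t _
    rw [Set.indicator_apply]
    split_ifs
    · exact ENNReal.ofReal_ne_top
    · exact ENNReal.zero_ne_top

section Probabilities

variable (a b : Bool) (x y : Fin 5)

theorem kcbs_prob_univ :
    kcbsPhenomenon.prob Set.univ (Obs.assign a b x y) = kcbsChoice x y * kcbsCond a b x y := by
  simp [-Fintype.univ_bool, kcbsPhenomenon_prob]

theorem kcbs_prob_A_B_XY : kcbsPhenomenon.prob ({.A} ∪ {.B} ∪ {.X, .Y}) (Obs.assign a b x y) =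
    kcbsChoice x y * kcbsCond a b x y := by
  simp [-Fintype.univ_bool, kcbsPhenomenon_prob]

theorem kcbs_prob_AB_XY : kcbsPhenomenon.prob ({.A, .B} ∪ {.X, .Y}) (Obs.assign a b x y) =
    kcbsChoice x y * kcbsCond a b x y := by
  simp [-Fintype.univ_bool, kcbsPhenomenon_prob]

theorem kcbs_prob_XY :
    kcbsPhenomenon.prob {.X, .Y} (Obs.assign a b x y) = kcbsChoice x y := by
  simp [-Fintype.univ_bool, kcbsPhenomenon_prob, ← Finset.mul_sum]

theorem kcbs_prob_A_XY : kcbsPhenomenon.prob ({.A} ∪ {.X, .Y}) (Obs.assign a b x y) =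
    kcbsChoice x y * kcbsMarginal a := by
  simp [-Fintype.univ_bool, kcbsPhenomenon_prob, ← Finset.mul_sum]

theorem kcbs_prob_B_XY : kcbsPhenomenon.prob ({.B} ∪ {.X, .Y}) (Obs.assign a b x y) =
    kcbsChoice x y * kcbsMarginal b := by
  simp [-Fintype.univ_bool, kcbsPhenomenon_prob, ← Finset.mul_sum]

theorem kcbs_prob_A : kcbsPhenomenon.prob {.A} (Obs.assign a b x y) = kcbsMarginal a := by
  simp [-Fintype.univ_bool, kcbsPhenomenon_prob, ← Finset.mul_sum, ← Finset.sum_mul]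

theorem kcbs_prob_B : kcbsPhenomenon.prob {.B} (Obs.assign a b x y) = kcbsMarginal b := by
  simp [-Fintype.univ_bool, kcbsPhenomenon_prob, ← Finset.mul_sum, ← Finset.sum_mul]

theorem kcbs_prob_X : kcbsPhenomenon.prob {.X} (Obs.assign a b x y) = 1 / 5 := by
  simp [-Fintype.univ_bool, kcbsPhenomenon_prob, ← Finset.mul_sum]

theorem kcbs_prob_Y : kcbsPhenomenon.prob {.Y} (Obs.assign a b x y) = 1 / 5 := by
  simp [-Fintype.univ_bool, kcbsPhenomenon_prob, ← Finset.mul_sum]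

theorem kcbs_prob_A_X : kcbsPhenomenon.prob ({.A} ∪ {.X}) (Obs.assign a b x y) =
    1 / 5 * kcbsMarginal a := by
  simp [-Fintype.univ_bool, kcbsPhenomenon_prob, ← Finset.mul_sum, ← Finset.sum_mul]

theorem kcbs_prob_B_Y : kcbsPhenomenon.prob ({.B} ∪ {.Y}) (Obs.assign a b x y) =
    1 / 5 * kcbsMarginal b := by
  simp [-Fintype.univ_bool, kcbsPhenomenon_prob, ← Finset.mul_sum, ← Finset.sum_mul]

end Probabilities

/-! ### No-disturbance and the failure of faithfulness. -/

theorem kcbs_noDisturbance : kcbsPhenomenon.NoDisturbance := by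
  intro ω
  obtain ⟨a, b, x, y, rfl⟩ := Obs.exists_eq_assign ω
  intro h
  rw [kcbs_prob_XY] at h
  simp only [Phenomenon.condProb, kcbs_prob_A_XY, kcbs_prob_B_XY, kcbs_prob_XY, kcbs_prob_A_X,
    kcbs_prob_B_Y, kcbs_prob_X, kcbs_prob_Y, mul_div_cancel_left₀ _ h]
  constructor <;> ring

theorem kcbs_not_isFaithful (Γ : CausalModel kcbsPhenomenon) : ¬ Γ.IsFaithful := by
  intro hΓ
  have hA : kcbsPhenomenon.CondIndep {.A} {.X, .Y} ∅ := by
    rw [Phenomenon.condIndep_empty_iff]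
    intro ω
    obtain ⟨a, b, x, y, rfl⟩ := Obs.exists_eq_assign ω
    rw [kcbs_prob_A_XY, kcbs_prob_A, kcbs_prob_XY, mul_comm]
  have hB : kcbsPhenomenon.CondIndep {.B} {.X, .Y} ∅ := by
    rw [Phenomenon.condIndep_empty_iff]
    intro ω
    obtain ⟨a, b, x, y, rfl⟩ := Obs.exists_eq_assign ω
    rw [kcbs_prob_B_XY, kcbs_prob_B, kcbs_prob_XY, mul_comm]
  have h := (Phenomenon.condIndep_empty_iff _ _ _).1
    (hΓ.condIndep_union (by simp) (by simp) hA hB)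
  have h₀ := h (Obs.assign true true (0 : Fin 5) (0 : Fin 5))
  have h₁ := h (Obs.assign true true (0 : Fin 5) (1 : Fin 5))
  -- The event on the outcomes alone ignores the settings, so joint independence would force equal
  -- conditional probabilities at the settings (0, 0) and (0, 1).
  have e : kcbsPhenomenon.prob ({.A} ∪ {.B}) (Obs.assign true true (0 : Fin 5) (0 : Fin 5)) =
      kcbsPhenomenon.prob ({.A} ∪ {.B}) (Obs.assign true true (0 : Fin 5) (1 : Fin 5)) := by
    simp [Phenomenon.prob, Obs.assign]
  have c₀ : kcbsChoice 0 0 = 1 / 15 := if_pos (by decide)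
  have c₁ : kcbsChoice 0 1 = 1 / 15 := if_pos (by decide)
  rw [kcbs_prob_A_B_XY, kcbs_prob_XY] at h₀ h₁
  rw [e, c₀] at h₀
  rw [c₁] at h₁
  have h₄ : kcbsCond true true 0 0 = kcbsCond true true 0 1 := by linarith
  simp [kcbsCond] at h₄

/-! ### Violation of a Kochen–Specker inequality -/

/-- Anticorrelation of consecutive measurements, minus the disagreement of equal ones. -/
noncomputable def pentagonCoeff (a b : Bool) (x y : Fin 5) : ℝ :=
  if a = b then 0 else if y = x + 1 then 1 else if x = y then -1 else 0

theorem sum_pentagonCoeff_mul (q : Bool → Bool → Fin 5 → Fin 5 → ℝ) :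
    ∑ a, ∑ b, ∑ x, ∑ y, pentagonCoeff a b x y * q a b x y =
      ∑ x, (q true false x (x + 1) + q false true x (x + 1) - q true false x x -
        q false true x x) := by
  have h : ∀ (F : Fin 5 → Fin 5 → ℝ) (x : Fin 5),
      ∑ y, (if y = x + 1 then (1 : ℝ) else if x = y then -1 else 0) * F x y =
        F x (x + 1) - F x x := by
    intro F x
    have e : ∀ y, (if y = x + 1 then (1 : ℝ) else if x = y then -1 else 0) * F x y =
        (if y = x + 1 then F x y else 0) - (if x = y then F x y else 0) := by
      intro y
      have : x ≠ x + 1 := by revert x; decide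
      split_ifs with h₁ h₂
      · exact absurd (h₂.trans h₁) this
      all_goals ring
    simp [e]
  simp only [Fintype.sum_bool, pentagonCoeff, if_true, zero_mul, zero_add,
    add_zero, reduceCtorEq, if_false, h, ← Finset.sum_add_distrib]
  exact Finset.sum_congr rfl fun x _ => by ring

/-- The probability that independent bits with expectations `u` and `v` disagree. -/
def disagreement (u v : ℝ) : ℝ := u * (1 - v) + (1 - u) * v

/-- For independent bits, the slack is twice the probability that the outer two agree and the middle
one differs from them. -/
theorem disagreement_triangle {u v w : ℝ} (hu : u ∈ Set.Icc (0 : ℝ) 1)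
    (hv : v ∈ Set.Icc (0 : ℝ) 1) (hw : w ∈ Set.Icc (0 : ℝ) 1) :
    disagreement u w ≤ disagreement u v + disagreement v w := by
  have h₁ : 0 ≤ v * ((1 - u) * (1 - w)) :=
    mul_nonneg hv.1 (mul_nonneg (sub_nonneg.2 hu.2) (sub_nonneg.2 hw.2))
  have h₂ : 0 ≤ (1 - v) * (u * w) := mul_nonneg (sub_nonneg.2 hv.2) (mul_nonneg hu.1 hw.1)
  unfold disagreement
  linarith

/-- A chained inequality along the ten-cycle u₀, v₁, u₁, v₂, …, u₄, v₀. The subtracted terms are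
needed since the two slots may use different response functions: u = 1, v = 0 would otherwise give
5. -/
theorem sum_disagreement_le (u v : Fin 5 → ℝ) (hu : ∀ x, u x ∈ Set.Icc (0 : ℝ) 1)
    (hv : ∀ x, v x ∈ Set.Icc (0 : ℝ) 1) :
    ∑ x, (disagreement (u x) (v (x + 1)) - disagreement (u x) (v x)) ≤ 4 := by
  have c : ∀ {t : ℝ}, t ∈ Set.Icc (0 : ℝ) 1 → 1 - t ∈ Set.Icc (0 : ℝ) 1 := fun ht =>
    ⟨sub_nonneg.2 ht.2, sub_le_self 1 ht.1⟩
  -- Complementing a bit turns a disagreement `s` into `1 - s`. Thus `down` and `up` are triangle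
  -- inequalities along u_x, v_{x+1}, u_{x+1} with the bit flipped at each step; used alternately,
  -- they telescope from u₀ to u₄.
  have down : ∀ x, 1 - disagreement (v 0) (u (x + 1)) ≤ disagreement (v 0) (u x) +
      1 - disagreement (u x) (v (x + 1)) + disagreement (u (x + 1)) (v (x + 1)) := by
    intro x
    have h₁ := disagreement_triangle (hv 0) (hu x) (c (hu (x + 1)))
    have h₂ := disagreement_triangle (hu x) (c (hv (x + 1))) (c (hu (x + 1)))
    simp only [disagreement] at *
    linarith
  have up : ∀ x, disagreement (v 0) (u (x + 1)) ≤ 1 - disagreement (v 0) (u x) +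
      1 - disagreement (u x) (v (x + 1)) + disagreement (u (x + 1)) (v (x + 1)) := by
    intro x
    have h₁ := disagreement_triangle (hv 0) (c (hu x)) (hu (x + 1))
    have h₂ := disagreement_triangle (c (hu x)) (hv (x + 1)) (hu (x + 1))
    simp only [disagreement] at *
    linarith
  have comm : ∀ s t, disagreement s t = disagreement t s := fun s t => by
    unfold disagreement; ring
  have h₀ := down 0
  have h₁ := up 1
  have h₂ := down 2
  have h₃ := up 3
  rw [comm (v 0) (u 0)] at h₀
  rw [comm (v 0) (u (3 + 1))] at h₃
  simp only [Fin.sum_univ_five]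
  change _ - disagreement (u 0) (v 0) + (_ - disagreement (u (0 + 1)) (v (0 + 1))) +
    (_ - disagreement (u (1 + 1)) (v (1 + 1))) + (_ - disagreement (u (2 + 1)) (v (2 + 1))) +
    (disagreement (u (3 + 1)) (v 0) - disagreement (u (3 + 1)) (v (3 + 1))) ≤ 4
  simp only [Fin.reduceAdd, zero_add] at *
  linarith

theorem isKSInequality_pentagonCoeff : pentagonScenario.IsKSInequality pentagonCoeff 4 := by
  refine ⟨?_, ?_⟩
  · intro a b x y h
    rw [pair_mem_pentagonScenario_iff] at h
    simp only [pentagonCompatible, not_or] at h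
    simp [pentagonCoeff, h.1, h.2.1]
  · rintro q ⟨L, _, μ, _, f, g, hfm, hgm, hf, hg, hf1, hg1, hq⟩
    have hle : ∀ {h : Bool → Fin 5 → L → ℝ}, (∀ o m l, 0 ≤ h o m l) →
        (∀ m l, ∑ o, h o m l = 1) → ∀ o m l, h o m l ≤ 1 := by
      intro h h0 h1 o m l
      rw [← h1 m l]
      exact Finset.single_le_sum (fun o _ => h0 o m l) (Finset.mem_univ o)
    have hint : ∀ a b x y, Integrable (fun l => f a x l * g b y l) μ := by
      intro a b x y
      refine Integrable.of_bound ((hfm a x).mul (hgm b y)).aestronglyMeasurable 1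
        (Filter.Eventually.of_forall fun l => ?_)
      rw [Real.norm_of_nonneg (mul_nonneg (hf a x l) (hg b y l))]
      exact mul_le_one₀ (hle hf hf1 a x l) (hg b y l) (hle hg hg1 b y l)
    have h₁ : ∀ x a b, q a b x (x + 1) = ∫ l, f a x l * g b (x + 1) l ∂μ := fun x a b =>
      hq x (x + 1) ((pair_mem_pentagonScenario_iff _ _).2 (.inr (.inl rfl))) a b
    have h₂ : ∀ x a b, q a b x x = ∫ l, f a x l * g b x l ∂μ := fun x a b =>
      hq x x ((pair_mem_pentagonScenario_iff _ _).2 (.inl rfl)) a b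
    have hsum : ∀ x, Integrable (fun l => f true x l * g false (x + 1) l +
        f false x l * g true (x + 1) l - f true x l * g false x l -
          f false x l * g true x l) μ := fun x =>
      (((hint _ _ _ _).add (hint _ _ _ _)).sub (hint _ _ _ _)).sub (hint _ _ _ _)
    have e : ∀ x, q true false x (x + 1) + q false true x (x + 1) - q true false x x -
        q false true x x = ∫ l, (f true x l * g false (x + 1) l +
          f false x l * g true (x + 1) l - f true x l * g false x l -
            f false x l * g true x l) ∂μ := by
      intro x
      have i₁ : Integrable (fun l => f true x l * g false (x + 1) l +
          f false x l * g true (x + 1) l) μ := (hint _ _ _ _).add (hint _ _ _ _)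
      have i₂ : Integrable (fun l => f true x l * g false (x + 1) l +
          f false x l * g true (x + 1) l - f true x l * g false x l) μ := i₁.sub (hint _ _ _ _)
      rw [h₁, h₁, h₂, h₂, integral_sub i₂ (hint _ _ _ _), integral_sub i₁ (hint _ _ _ _),
        integral_add (hint _ _ _ _) (hint _ _ _ _)]
    rw [sum_pentagonCoeff_mul, Finset.sum_congr rfl fun x _ => e x,
      ← integral_finsetSum _ fun x _ => hsum x]
    -- At each hidden value the outcomes are independent bits, so the bound holds pointwise and is
    -- then integrated.
    have hb : ∀ l, ∑ x, (f true x l * g false (x + 1) l + f false x l * g true (x + 1) l -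
        f true x l * g false x l - f false x l * g true x l) ≤ 4 := by
      intro l
      have key := sum_disagreement_le (fun x => f true x l) (fun x => g true x l)
        (fun x => ⟨hf _ _ _, hle hf hf1 _ _ _⟩) (fun x => ⟨hg _ _ _, hle hg hg1 _ _ _⟩)
      refine le_trans (le_of_eq (Finset.sum_congr rfl fun x _ => ?_)) key
      have f1 : f false x l = 1 - f true x l := by
        rw [← hf1 x l, Fintype.sum_bool]; ring
      have g1 : ∀ y, g false y l = 1 - g true y l := fun y => by
        rw [← hg1 y l, Fintype.sum_bool]; ring
      rw [f1, g1, g1, disagreement, disagreement]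
      ring
    have := integral_mono (integrable_finsetSum _ fun x _ => hsum x)
      (integrable_const (4 : ℝ)) hb (μ := μ)
    simpa using this

theorem kcbs_violatesKSInequality : kcbsPhenomenon.ViolatesKSInequality := by
  refine ⟨pentagonCoeff, 4, isKSInequality_pentagonCoeff, ?_, ?_⟩
  · intro a b x y h
    rw [kcbs_prob_XY] at h
    refine isKSInequality_pentagonCoeff.1 a b x y fun hxy => ?_
    rw [pair_mem_pentagonScenario_iff] at hxy
    simp [kcbsChoice, hxy] at h
  · have h : ∀ a b x y, pentagonCompatible x y → kcbsPhenomenon.condProb {.A, .B} {.X, .Y}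
        (Obs.assign a b x y) = kcbsCond a b x y := by
      intro a b x y hxy
      have h0 : kcbsChoice x y ≠ 0 := by simp [kcbsChoice, hxy]
      rw [Phenomenon.condProb, kcbs_prob_AB_XY, kcbs_prob_XY, mul_div_cancel_left₀ _ h0]
    rw [sum_pentagonCoeff_mul
      (fun a b x y => kcbsPhenomenon.condProb {.A, .B} {.X, .Y} (Obs.assign a b x y))]
    have e : ∀ x : Fin 5, x ≠ x + 1 := by decide
    simp only [h _ _ _ _ (Or.inr (Or.inl rfl)), h _ _ _ _ (Or.inl rfl), kcbsCond, e, if_true,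
      if_false, Finset.sum_const, Finset.card_univ, Fintype.card_fin, nsmul_eq_mul]
    -- The five consecutive pairs contribute 2√5/5 each and the equal pairs nothing: 2√5 > 4.
    have : (2 : ℝ) < √5 := Real.lt_sqrt_of_sq_lt (by norm_num)
    push_cast
    linarith

/-! ### Quantum realisation on a three-dimensional system -/

/-- The KCBS vectors in `ℝ³`. -/
noncomputable def kcbsVec (x : Fin 5) : Fin 3 → ℝ :=
  ![√(√5 / 5), √(1 - √5 / 5) * Real.cos (4 * Real.pi / 5 * x.val),
    √(1 - √5 / 5) * Real.sin (4 * Real.pi / 5 * x.val)]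

theorem kcbsVec_dotProduct (x y : Fin 5) : kcbsVec x ⬝ᵥ kcbsVec y =
    √5 / 5 + (1 - √5 / 5) * Real.cos (4 * Real.pi / 5 * x.val - 4 * Real.pi / 5 * y.val) := by
  have h0 : 0 ≤ √5 / 5 := by positivity
  have h1 : √5 / 5 ≤ 1 := by
    have : √5 ≤ 5 := Real.sqrt_le_iff.2 ⟨by norm_num, by norm_num⟩
    linarith
  simp only [kcbsVec, dotProduct, Fin.sum_univ_three, Matrix.cons_val_zero, Matrix.cons_val_one,
    Matrix.cons_val]
  rw [Real.cos_sub]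
  linear_combination Real.mul_self_sqrt h0 + (Real.cos (4 * Real.pi / 5 * x.val) *
    Real.cos (4 * Real.pi / 5 * y.val) + Real.sin (4 * Real.pi / 5 * x.val) *
    Real.sin (4 * Real.pi / 5 * y.val)) * Real.mul_self_sqrt (sub_nonneg.2 h1)

theorem kcbsVec_dotProduct_self (x : Fin 5) : kcbsVec x ⬝ᵥ kcbsVec x = 1 := by
  rw [kcbsVec_dotProduct, sub_self, Real.cos_zero]; ring

/-- The squared height √5/5 is the one that makes vectors at azimuthal angle 4π/5 orthogonal,
because cos(4π/5) = -(1 + √5)/4. -/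
theorem kcbsVec_dotProduct_succ (x : Fin 5) : kcbsVec x ⬝ᵥ kcbsVec (x + 1) = 0 := by
  have h : Real.cos (4 * Real.pi / 5 * x.val - 4 * Real.pi / 5 * (x + 1).val) =
      -((1 + √5) / 4) := by
    rw [← Real.cos_pi_div_five, ← Real.cos_pi_sub]
    -- At `x = 4` the successor wraps to 0, and the angle 16π/5 is -4π/5 plus two full turns.
    by_cases hx : x = 4
    · have e : 4 * Real.pi / 5 * x.val - 4 * Real.pi / 5 * (x + 1).val =
          -(Real.pi - Real.pi / 5) + 2 * Real.pi + 2 * Real.pi := by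
        have e₀ : (x + 1).val = 0 := by subst hx; rfl
        have e₄ : x.val = 4 := by subst hx; rfl
        rw [e₀, e₄]
        push_cast
        ring
      rw [e, Real.cos_add_two_pi, Real.cos_add_two_pi, Real.cos_neg]
    · have : (x + 1).val = x.val + 1 := by revert x; decide
      rw [this, ← Real.cos_neg]
      congr 1
      push_cast
      ring
  rw [kcbsVec_dotProduct, h]
  have := Real.mul_self_sqrt (show (0 : ℝ) ≤ 5 by norm_num)
  linear_combination (1 / 20) * this

/-- The projector onto a KCBS vector. -/
noncomputable def kcbsProj (x : Fin 5) : Matrix (Fin 3) (Fin 3) ℝ :=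
  Matrix.vecMulVec (kcbsVec x) (kcbsVec x)

theorem kcbsProj_mul (x y : Fin 5) : kcbsProj x * kcbsProj y =
    (kcbsVec x ⬝ᵥ kcbsVec y) • Matrix.vecMulVec (kcbsVec x) (kcbsVec y) := by
  rw [kcbsProj, kcbsProj, Matrix.vecMulVec_mul_vecMulVec, Matrix.vecMulVec_smul]

theorem kcbsProj_mul_self (x : Fin 5) : kcbsProj x * kcbsProj x = kcbsProj x := by
  rw [kcbsProj_mul, kcbsVec_dotProduct_self, one_smul, kcbsProj]

theorem kcbsProj_transpose (x : Fin 5) : (kcbsProj x).transpose = kcbsProj x := by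
  rw [kcbsProj, Matrix.transpose_vecMulVec]

theorem kcbsProj_mul_eq_zero {x y : Fin 5} (h : y = x + 1 ∨ x = y + 1) :
    kcbsProj x * kcbsProj y = 0 := by
  rw [kcbsProj_mul]
  rcases h with rfl | rfl
  · rw [kcbsVec_dotProduct_succ, zero_smul]
  · rw [dotProduct_comm, kcbsVec_dotProduct_succ, zero_smul]

/-- The two-outcome projective measurement of a KCBS projector. -/
noncomputable def kcbsMeasurement (x : Fin 5) (a : Bool) : Matrix (Fin 3) (Fin 3) ℝ :=
  if a then kcbsProj x else 1 - kcbsProj x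

/-- The pure state along the symmetry axis of the KCBS vectors. -/
noncomputable def kcbsState : Matrix (Fin 3) (Fin 3) ℝ :=
  Matrix.vecMulVec (Pi.single 0 1) (Pi.single 0 1)

theorem trace_kcbsState_mul (A : Matrix (Fin 3) (Fin 3) ℝ) : (kcbsState * A).trace = A 0 0 := by
  simp [kcbsState, Matrix.trace, Matrix.mul_apply, Matrix.vecMulVec_apply, Fin.sum_univ_three]

theorem kcbsProj_zero_zero (x : Fin 5) : kcbsProj x 0 0 = √5 / 5 := by
  simp only [kcbsProj, Matrix.vecMulVec_apply, kcbsVec, Matrix.cons_val_zero]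
  exact Real.mul_self_sqrt (by positivity)

theorem kcbsMeasurement_mul_zero_zero (a b : Bool) {x y : Fin 5} (h : pentagonCompatible x y) :
    (kcbsMeasurement x a * kcbsMeasurement y b) 0 0 = kcbsCond a b x y := by
  by_cases hxy : x = y
  · subst hxy
    cases a <;> cases b <;>
      simp [kcbsMeasurement, kcbsCond, mul_sub, sub_mul, kcbsProj_mul_self, kcbsProj_zero_zero]
  · have h0 := kcbsProj_mul_eq_zero (h.resolve_left hxy)
    cases a <;> cases b <;>
      simp [kcbsMeasurement, kcbsCond, mul_sub, sub_mul, h0, kcbsProj_zero_zero, hxy]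
    ring

theorem commute_kcbsProj {x y : Fin 5} (h : pentagonCompatible x y) :
    Commute (kcbsProj x) (kcbsProj y) := by
  rcases h with rfl | h
  · exact Commute.refl _
  · rw [commute_iff_eq, kcbsProj_mul_eq_zero h, kcbsProj_mul_eq_zero h.symm]

theorem commute_kcbsMeasurement (a b : Bool) {x y : Fin 5} (h : pentagonCompatible x y) :
    Commute (kcbsMeasurement x a) (kcbsMeasurement y b) := by
  have h0 := commute_kcbsProj h
  cases a <;> cases b <;> simp only [kcbsMeasurement, if_true, if_false, reduceCtorEq]
  · exact ((Commute.one_left _).sub_left ((Commute.one_right _).sub_right h0))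
  · exact (Commute.one_left _).sub_left h0
  · exact (Commute.one_right _).sub_right h0
  · exact h0

theorem kcbs_isQuantum : kcbsPhenomenon.IsQuantum 3 := by
  -- All matrices are real, so the identities are proved over ℝ and carried to ℂ by this ring
  -- homomorphism.
  let φ : Matrix (Fin 3) (Fin 3) ℝ →+* Matrix (Fin 3) (Fin 3) ℂ := Complex.ofRealHom.mapMatrix
  have hherm : ∀ A : Matrix (Fin 3) (Fin 3) ℝ, A.transpose = A → star (φ A) = φ A := by
    intro A hA
    ext i j
    have := congrFun (congrFun hA i) j
    simp only [Matrix.transpose_apply] at this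
    simp [φ, this]
  have htr : ∀ A, (φ A).trace = (A.trace : ℂ) := by
    intro A
    simp [φ, Matrix.trace]
  refine ⟨φ kcbsState, fun x a => φ (kcbsMeasurement x a), ?_, ?_, ?_, ?_, ?_, ?_⟩
  · have : φ kcbsState = Matrix.vecMulVec (Pi.single 0 1) (star (Pi.single 0 1)) := by
      ext i j
      fin_cases i <;> fin_cases j <;> simp [φ, kcbsState, Matrix.vecMulVec_apply]
    rw [this]
    exact Matrix.posSemidef_vecMulVec_self_star _
  · rw [htr, ← mul_one kcbsState, trace_kcbsState_mul]
    simp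
  · intro x a
    constructor
    · change φ _ * φ _ = φ _
      rw [← map_mul]
      congr 1
      cases a <;> simp [kcbsMeasurement, mul_sub, sub_mul, kcbsProj_mul_self]
    · refine hherm _ ?_
      cases a <;> simp [kcbsMeasurement, kcbsProj_transpose]
  · intro x
    rw [Fintype.sum_bool, ← map_add]
    simp [kcbsMeasurement]
  · intro x y h a b
    exact (commute_kcbsMeasurement a b ((pair_mem_pentagonScenario_iff x y).1 h)).map φ
  · intro a b x y
    rw [kcbs_prob_univ, kcbs_prob_XY, ← map_mul, ← map_mul, htr, trace_kcbsState_mul]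
    by_cases h : pentagonCompatible x y
    · rw [kcbsMeasurement_mul_zero_zero a b h]
      push_cast
      rfl
    -- Incompatible settings have probability zero, so nothing is asked of the trace.
    · simp [kcbsChoice, h]

/-- There is a contextuality scenario and a quantum phenomenon in it, on a single system whose
Hilbert space has prime dimension (hence is not a tensor product of nontrivial factors), that obeys
no-disturbance, violates a KS-inequality, and has no causal model without fine-tuning. -/
theorem corollary3 :
    ∃ (M O : Type) (_ : Fintype M) (_ : Fintype O) (S : BinaryScenario M) (P : Phenomenon S O)
      (d : ℕ), d.Prime ∧ P.IsQuantum d ∧ P.NoDisturbance ∧ P.ViolatesKSInequality ∧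
        ∀ Γ : CausalModel P, ¬ Γ.IsFaithful :=
  ⟨Fin 5, Bool, inferInstance, inferInstance, pentagonScenario, kcbsPhenomenon, 3, Nat.prime_three,
    kcbs_isQuantum, kcbs_noDisturbance, kcbs_violatesKSInequality, kcbs_not_isFaithful⟩
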